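/- Let $n\ge 0$ be an integer and $\hbar>0$. Write points of $\mathbb{R}^{2n}$ as $z=(x,p)$ with $x,p\in\mathbb{R}^n$, put $J(x,p)=(p,-x)$ and $\sigma(z,z')=Jz\cdot z'=p\cdot x'-p'\cdot x$. For $z_0=(x_0,p_0)$ let $\widehat T(z_0)$ be the Heisenberg operator $$\widehat T(z_0)\psi(x)=e^{\frac{i}{\hbar}(p_0\cdot x-\frac12 p_0\cdot x_0)}\psi(x-x_0),\qquad \psi\in\mathcal S(\mathbb R^n),$$ let $$\Theta(z)=\frac{\sin(p\cdot x/2\hbar)}{p\cdot x/2\hbar}\quad(\Theta(z)=1\text{ if }p\cdot x=0),$$ and for $a\in\mathcal S'(\mathbb R^{2n})$ let $a_\sigma$ be the symplectic Fourier transform, formally $a_\sigma(z)=(2\pi\hbar)^{-n}\int_{\mathbb R^{2n}} e^{-\frac{i}{\hbar}\sigma(z,z')}a(z')\,dz'$, extended to $\mathcal S'(\mathbb R^{2n})$ in the usual way. The Born--Jordan operator with symbol $a\in\mathcal S'(\mathbb R^{2n})$ is the continuous linear operator $\operatorname{Op}_{\mathrm{BJ}}(a):\mathcal S(\mathbb R^n)\to\mathcal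 S'(\mathbb R^n)$, $$\operatorname{Op}_{\mathrm{BJ}}(a)\psi=\Big(\tfrac{1}{2\pi\hbar}\Big)^{n}\int_{\mathbb R^{2n}}a_\sigma(z)\,\Theta(z)\,\widehat T(z)\psi\,dz,$$ the integral being understood weakly: $\langle\operatorname{Op}_{\mathrm{BJ}}(a)\psi,\varphi\rangle=(2\pi\hbar)^{-n}\langle\Theta a_\sigma,\ \langle\widehat T(\cdot)\psi,\varphi\rangle\rangle$ for $\psi,\varphi\in\mathcal S(\mathbb R^n)$, with bilinear pairings. Let $\operatorname{Mp}(2n,\mathbb R)$ be the metaplectic group, that is, the group of unitary operators on $L^2(\mathbb R^n)$ generated by $$\widehat J\psi(x)=e^{-in\pi/4}(2\pi\hbar)^{-n/2}\int_{\mathbb R^n} e^{-\frac{i}{\hbar}x\cdot x'}\psi(x')\,dx',\qquad \widehat M_{L,m}\psi(x)=i^m\sqrt{|\det L|}\,\psi(Lx),\qquad \widehat V_P\psi(x)=e^{-\frac{i}{2\hbar}Px\cdot x}\psi(x),$$ where $L\in GL(n,\mathbb R)$, $m$ is an integer such that $m\pi$ is an argument of $\det L$, and $P$ is a real symmetric $n\times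 n$ matrix. These operators restrict to automorphisms of $\mathcal S(\mathbb R^n)$ and extend to automorphisms of $\mathcal S'(\mathbb R^n)$. Let $\pi^{\mathrm{Mp}}:\operatorname{Mp}(2n,\mathbb R)\to\operatorname{Sp}(2n,\mathbb R)$ be the covering projection, that is, the group homomorphism with $$\pi^{\mathrm{Mp}}(\widehat J)=J,\qquad \pi^{\mathrm{Mp}}(\widehat M_{L,m})=\begin{pmatrix}L^{-1}&0\\0&L^{T}\end{pmatrix},\qquad \pi^{\mathrm{Mp}}(\widehat V_P)=\begin{pmatrix}I&0\\-P&I\end{pmatrix}.$$ Then for every $a\in\mathcal S'(\mathbb R^{2n})$ and every $\widehat S$ in the subgroup of $\operatorname{Mp}(2n,\mathbb R)$ generated by $\widehat J$ and all the $\widehat M_{L,m}$, with $s=\pi^{\mathrm{Mp}}(\widehat S)$, $$\widehat S\,\operatorname{Op}_{\mathrm{BJ}}(a)\,\widehat S^{-1}=\operatorname{Op}_{\mathrm{BJ}}(a\circ s^{-1})$$ as operators $\mathcal S(\mathbb R^n)\to\mathcal S'(\mathbb R^n)$. -/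

import Mathlib

open MeasureTheory SchwartzMap FourierTransform
open scoped ComplexConjugate Real ContDiff InnerProductSpace Matrix

noncomputable section

namespace BornJordan

variable {n : ℕ}

/-- Configuration space `ℝⁿ`. -/
abbrev Config (n : ℕ) := EuclideanSpace ℝ (Fin n)

/-- Phase space `ℝ²ⁿ`; a point is `z = (x, p)` with `x` in the left and `p` in the right block. -/
abbrev Phase (n : ℕ) := EuclideanSpace ℝ (Fin n ⊕ Fin n)

/-- The position component `x` of `z = (x, p)`. -/
def pos : Phase n →L[ℝ] Config n :=
  LinearMap.toContinuousLinearMap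
    { toFun := fun z => WithLp.toLp 2 fun i => z (Sum.inl i)
      map_add' := fun _ _ => rfl
      map_smul' := fun _ _ => rfl }

/-- The momentum component `p` of `z = (x, p)`. -/
def mom : Phase n →L[ℝ] Config n :=
  LinearMap.toContinuousLinearMap
    { toFun := fun z => WithLp.toLp 2 fun i => z (Sum.inr i)
      map_add' := fun _ _ => rfl
      map_smul' := fun _ _ => rfl }

/-- The point `(x, p)` of phase space. -/
def phasePt (x p : Config n) : Phase n := WithLp.toLp 2 (Sum.elim x p)

@[simp] theorem pos_apply (z : Phase n) (i : Fin n) : pos z i = z (Sum.inl i) := rfl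
@[simp] theorem mom_apply (z : Phase n) (i : Fin n) : mom z i = z (Sum.inr i) := rfl
@[simp] theorem pos_phasePt (x p : Config n) : pos (phasePt x p) = x := rfl
@[simp] theorem mom_phasePt (x p : Config n) : mom (phasePt x p) = p := rfl

theorem phase_ext {z w : Phase n} (h₁ : pos z = pos w) (h₂ : mom z = mom w) : z = w := by
  ext (i | i)
  · simpa using congrArg (fun v : Config n => v i) h₁
  · simpa using congrArg (fun v : Config n => v i) h₂

theorem phase_inner (z w : Phase n) : ⟪z, w⟫_ℝ = ⟪pos z, pos w⟫_ℝ + ⟪mom z, mom w⟫_ℝ := by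
  simp [PiLp.inner_apply, Fintype.sum_sum_type]

theorem phase_norm_sq (z : Phase n) : ‖z‖ ^ 2 = ‖pos z‖ ^ 2 + ‖mom z‖ ^ 2 := by
  simp [EuclideanSpace.norm_sq_eq, Fintype.sum_sum_type]

theorem norm_pos_le (z : Phase n) : ‖pos z‖ ≤ ‖z‖ :=
  le_of_sq_le_sq (by nlinarith [phase_norm_sq z, sq_nonneg ‖mom z‖]) (norm_nonneg _)

theorem norm_mom_le (z : Phase n) : ‖mom z‖ ≤ ‖z‖ :=
  le_of_sq_le_sq (by nlinarith [phase_norm_sq z, sq_nonneg ‖pos z‖]) (norm_nonneg _)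

theorem phase_norm_le (z : Phase n) : ‖z‖ ≤ ‖pos z‖ + ‖mom z‖ :=
  le_of_sq_le_sq (by nlinarith [phase_norm_sq z, norm_nonneg (pos z), norm_nonneg (mom z)])
    (by positivity)

/-- Lebesgue measure on phase space is the product of the Lebesgue measures. -/
theorem measurePreserving_phasePt :
    ∃ e : Config n × Config n ≃ᵐ Phase n,
      MeasurePreserving e ∧ ∀ q, e q = phasePt q.1 q.2 := by
  have h1 := EuclideanSpace.volume_preserving_symm_measurableEquiv_toLp (Fin n)
  have h2 := (EuclideanSpace.volume_preserving_symm_measurableEquiv_toLp (Fin n ⊕ Fin n)).symm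
  have h3 := volume_measurePreserving_sumPiEquivProdPi_symm (fun _ : Fin n ⊕ Fin n => ℝ)
  refine ⟨((MeasurableEquiv.toLp 2 (Fin n → ℝ)).symm.prodCongr
    (MeasurableEquiv.toLp 2 (Fin n → ℝ)).symm).trans
      ((MeasurableEquiv.sumPiEquivProdPi (fun _ : Fin n ⊕ Fin n => ℝ)).symm.trans
        (MeasurableEquiv.toLp 2 (Fin n ⊕ Fin n → ℝ))), h2.comp (h3.comp (h1.prod h1)), ?_⟩
  intro q
  ext (i | i) <;> rfl

theorem phase_integral (f : Phase n → ℂ) :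
    ∫ z, f z = ∫ q : Config n × Config n, f (phasePt q.1 q.2) := by
  obtain ⟨e, he, hq⟩ := measurePreserving_phasePt (n := n)
  rw [← he.integral_comp' f]
  simp [hq]

theorem phase_integrable {f : Phase n → ℂ} (hf : Integrable f) :
    Integrable (fun q : Config n × Config n => f (phasePt q.1 q.2)) := by
  obtain ⟨e, he, hq⟩ := measurePreserving_phasePt (n := n)
  have := (he.integrable_comp_emb e.measurableEmbedding).2 hf
  simpa [Function.comp_def, hq] using this

theorem hasTemperateGrowth_cexp : (fun t : ℝ => Complex.exp (t * Complex.I)).HasTemperateGrowth := by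
  refine ⟨Complex.contDiff_exp.comp (Complex.ofRealCLM.contDiff.mul contDiff_const), fun k => ⟨0, 1, fun t => ?_⟩⟩
  rw [norm_iteratedFDeriv_eq_norm_iteratedDeriv]
  have : ∀ t : ℝ, iteratedDeriv k (fun t : ℝ => Complex.exp (t * Complex.I)) t
      = Complex.I ^ k * Complex.exp (t * Complex.I) := by
    induction k with
    | zero => simp
    | succ k ih =>
      intro t
      rw [iteratedDeriv_succ, funext ih]
      have : HasDerivAt (fun t : ℝ => Complex.exp (t * Complex.I))
          (Complex.exp (t * Complex.I) * (1 * Complex.I)) t :=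
        ((Complex.ofRealCLM.hasDerivAt (x := t)).mul_const Complex.I).cexp
      rw [(this.const_mul _).deriv]
      ring
  rw [this]
  simp [Complex.norm_exp_ofReal_mul_I]

theorem hasTemperateGrowth_cexp_comp {E : Type*} [NormedAddCommGroup E] [NormedSpace ℝ E]
    {f : E → ℝ} (hf : f.HasTemperateGrowth) :
    (fun x => Complex.exp ((f x : ℝ) * Complex.I)).HasTemperateGrowth :=
  hasTemperateGrowth_cexp.comp hf

theorem hasTemperateGrowth_sinc : Real.sinc.HasTemperateGrowth := by
  set r : ℝ := (2 * π)⁻¹ with hr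
  set f : ℝ → ℂ := (Set.Ioc (-r) r).indicator fun _ => (π : ℂ) with hf
  have hr0 : 0 < r := by positivity
  have hint : ∀ g : ℝ → ℂ, Continuous g → Integrable (fun v => g v * f v) := by
    intro g hg
    have : (fun v => g v * f v) = (Set.Ioc (-r) r).indicator fun v => g v * π := by
      ext v; simp [hf, Set.indicator]
    rw [this, integrable_indicator_iff measurableSet_Ioc]
    exact ((hg.mul continuous_const).continuousOn.integrableOn_Icc).mono_set Set.Ioc_subset_Icc_self
  have key : ∀ t : ℝ, 𝓕 f t = (Real.sinc t : ℂ) := by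
    intro t
    have h1 : 𝓕 f t = ∫ v in -r..r, Complex.exp (((-2 * π * t * v : ℝ) : ℂ) * Complex.I) * π := by
      rw [Real.fourier_real_eq_integral_exp_smul, intervalIntegral.integral_of_le (by linarith),
        ← integral_indicator measurableSet_Ioc]
      congr 1
      ext v
      simp only [hf, Set.indicator]
      split_ifs
      · simp; congr 1; ring
      · simp
    rw [h1]
    rcases eq_or_ne t 0 with rfl | ht
    · simp [hr]
      field_simp
      norm_num
    · have h2 := intervalIntegral.integral_comp_mul_left
        (fun u : ℝ => Complex.exp ((u : ℂ) * Complex.I)) (a := -r) (b := r) (c := -2 * π * t)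
        (by simp [ht, Real.pi_ne_zero])
      have e1 : -2 * π * t * -r = t := by rw [hr]; field_simp
      have e2 : -2 * π * t * r = -t := by rw [hr]; field_simp
      rw [intervalIntegral.integral_mul_const, h2, e1, e2, intervalIntegral.integral_symm,
        integral_exp_mul_I_eq_sinc]
      have : (t : ℂ) ≠ 0 := by exact_mod_cast ht
      have hpi : (π : ℂ) ≠ 0 := by exact_mod_cast Real.pi_ne_zero
      simp
      field_simp
  have hI : ∀ k : ℕ, (k : ℕ∞) ≤ ⊤ → Integrable (fun x : ℝ => x ^ k • f x) := by
    intro k _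
    have := hint (fun v => ((v ^ k : ℝ) : ℂ)) (by fun_prop)
    simpa using this
  have hF : (𝓕 f).HasTemperateGrowth := by
    refine ⟨Real.contDiff_fourier (N := ⊤) fun k hk => ?_, fun k => ⟨0, ∫ v : ℝ, ‖(-2 * π * Complex.I * v) ^ k • f v‖, fun t => ?_⟩⟩
    · simpa [norm_smul] using (hI k hk).norm
    · rw [norm_iteratedFDeriv_eq_norm_iteratedDeriv, Real.iteratedDeriv_fourier hI le_top]
      simp only [pow_zero, mul_one]
      exact VectorFourier.norm_fourierIntegral_le_integral_norm _ _ _ _ _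
  have hre : Real.sinc = Complex.reCLM ∘ 𝓕 f := by
    ext t; simp [key]
  rw [hre]
  exact (Complex.reCLM.hasTemperateGrowth).comp hF

theorem hasTemperateGrowth_mom_pos :
    (fun z : Phase n => ⟪mom z, pos z⟫_ℝ).HasTemperateGrowth := by
  have := ContinuousLinearMap.bilinear_hasTemperateGrowth (𝕜 := ℝ) (innerSL ℝ (E := Config n)) (f := fun z : Phase n => mom z) (g := fun z => pos z) (by fun_prop) (by fun_prop)
  exact this

theorem norm_iteratedFDeriv_comp_le_of_norm_le_one (f : 𝓢(Config n, ℂ)) (g : Phase n →L[ℝ] Config n)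
    (hg : ‖g‖ ≤ 1) (i : ℕ) (z : Phase n) :
    ‖iteratedFDeriv ℝ i (fun w => f (g w)) z‖ ≤ ‖iteratedFDeriv ℝ i f (g z)‖ := by
  have h := g.iteratedFDeriv_comp_right (f := f) (f.smooth ⊤) z (i := i) (mod_cast le_top)
  change ‖iteratedFDeriv ℝ i (f ∘ g) z‖ ≤ _
  rw [h]
  refine (ContinuousMultilinearMap.norm_compContinuousLinearMap_le _ _).trans ?_
  refine mul_le_of_le_one_right (norm_nonneg _) ?_
  simpa using pow_le_one₀ (norm_nonneg _) hg

theorem opNorm_pos_le : ‖(pos : Phase n →L[ℝ] Config n)‖ ≤ 1 :=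
  ContinuousLinearMap.opNorm_le_bound _ zero_le_one fun z => by simpa using norm_pos_le z

theorem opNorm_mom_le : ‖(mom : Phase n →L[ℝ] Config n)‖ ≤ 1 :=
  ContinuousLinearMap.opNorm_le_bound _ zero_le_one fun z => by simpa using norm_mom_le z

/-- The tensor product `(x, p) ↦ f x * g p`, as a continuous linear function of `g`. -/
def tensorRight (f : 𝓢(Config n, ℂ)) : 𝓢(Config n, ℂ) →L[ℂ] 𝓢(Phase n, ℂ) :=
  mkCLM (fun g z => f (pos z) * g (mom z)) (fun _ _ _ => by simp [mul_add])
    (fun _ _ _ => by simp; ring)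
    (fun g => ((f.smooth ⊤).comp pos.contDiff).mul ((g.smooth ⊤).comp mom.contDiff)) <| by
  rintro ⟨k, m⟩
  set A : ℝ := (Finset.Iic (k, m)).sup (schwartzSeminormFamily ℂ (Config n) ℂ) f with hA
  have hA0 : 0 ≤ A := apply_nonneg _ _
  refine ⟨Finset.Iic (k, m), ∑ i ∈ Finset.range (m + 1), (m.choose i : ℝ) * (2 ^ k * A) * 2 ^ k,
    by positivity, fun g z => ?_⟩
  set B : ℝ := (Finset.Iic (k, m)).sup (schwartzSeminormFamily ℂ (Config n) ℂ) g with hB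
  have h1 := norm_iteratedFDeriv_mul_le (𝕜 := ℝ) (N := ∞) (f := fun z : Phase n => f (pos z))
    (g := fun z : Phase n => g (mom z)) ((f.smooth ⊤).comp pos.contDiff)
    ((g.smooth ⊤).comp mom.contDiff) z (n := m) (mod_cast le_top)
  have h2 : ‖z‖ ^ k ≤ (1 + ‖pos z‖) ^ k * (1 + ‖mom z‖) ^ k := by
    rw [← mul_pow]
    gcongr
    nlinarith [phase_norm_le z, mul_nonneg (norm_nonneg (pos z)) (norm_nonneg (mom z))]
  calc ‖z‖ ^ k * ‖iteratedFDeriv ℝ m (fun z => f (pos z) * g (mom z)) z‖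
      ≤ ((1 + ‖pos z‖) ^ k * (1 + ‖mom z‖) ^ k) *
        ∑ i ∈ Finset.range (m + 1), (m.choose i : ℝ) * ‖iteratedFDeriv ℝ i f (pos z)‖ *
          ‖iteratedFDeriv ℝ (m - i) g (mom z)‖ := by
        gcongr
        refine h1.trans ?_
        gcongr
        · exact norm_iteratedFDeriv_comp_le_of_norm_le_one f pos opNorm_pos_le _ z
        · exact norm_iteratedFDeriv_comp_le_of_norm_le_one g mom opNorm_mom_le _ z
    _ ≤ (∑ i ∈ Finset.range (m + 1), (m.choose i : ℝ) * (2 ^ k * A) * 2 ^ k) * B := by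
        rw [Finset.mul_sum, Finset.sum_mul]
        refine Finset.sum_le_sum fun i hi => ?_
        have hi' : i ≤ m := Nat.lt_succ_iff.1 (Finset.mem_range.1 hi)
        have e1 := one_add_le_sup_seminorm_apply (𝕜 := ℂ) (m := (k, m)) (k := k) le_rfl hi' f
          (pos z)
        have e2 := one_add_le_sup_seminorm_apply (𝕜 := ℂ) (m := (k, m)) (k := k) (n := m - i)
          le_rfl (Nat.sub_le _ _) g (mom z)
        change _ ≤ 2 ^ k * A at e1
        change _ ≤ 2 ^ k * B at e2
        calc _ = (m.choose i : ℝ) * ((1 + ‖pos z‖) ^ k * ‖iteratedFDeriv ℝ i f (pos z)‖) *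
              ((1 + ‖mom z‖) ^ k * ‖iteratedFDeriv ℝ (m - i) g (mom z)‖) := by ring
          _ ≤ (m.choose i : ℝ) * (2 ^ k * A) * (2 ^ k * B) := by gcongr
          _ = _ := by ring

@[simp] theorem tensorRight_apply (f g : 𝓢(Config n, ℂ)) (z : Phase n) :
    tensorRight f g z = f (pos z) * g (mom z) := rfl

/-- The linear automorphism `(x, p) ↦ (c p, d x)` of phase space. -/
def phaseEquiv (c d : ℝ) (hc : c ≠ 0) (hd : d ≠ 0) : Phase n ≃L[ℝ] Phase n :=
  LinearEquiv.toContinuousLinearEquiv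
    { toFun := fun z => phasePt (c • mom z) (d • pos z)
      invFun := fun z => phasePt (d⁻¹ • mom z) (c⁻¹ • pos z)
      map_add' := fun z w => by apply phase_ext <;> simp
      map_smul' := fun r z => by apply phase_ext <;> simp [smul_comm r]
      left_inv := fun z => by apply phase_ext <;> simp [smul_smul, hc, hd]
      right_inv := fun z => by apply phase_ext <;> simp [smul_smul, hc, hd] }

@[simp] theorem phaseEquiv_apply (c d : ℝ) (hc : c ≠ 0) (hd : d ≠ 0) (z : Phase n) :
    phaseEquiv c d hc hd z = phasePt (c • mom z) (d • pos z) := rfl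

/-- The tensor product `(x, p) ↦ f x * g p`, as a continuous linear function of `f`. -/
def tensorLeft (g : 𝓢(Config n, ℂ)) : 𝓢(Config n, ℂ) →L[ℂ] 𝓢(Phase n, ℂ) :=
  compCLMOfContinuousLinearEquiv ℂ (phaseEquiv 1 1 one_ne_zero one_ne_zero) ∘L tensorRight g

theorem tensorLeft_eq (f g : 𝓢(Config n, ℂ)) : tensorLeft g f = tensorRight f g := by
  ext z
  simp [tensorLeft, mul_comm]

/-- The Heisenberg operator
`(T̂(z₀)ψ)(x) = exp((i/ħ)(p₀·x - p₀·x₀/2)) ψ(x - x₀)`, `z₀ = (x₀, p₀)`. -/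
def heisenberg (ħ : ℝ) (z₀ : Phase n) : 𝓢(Config n, ℂ) →L[ℂ] 𝓢(Config n, ℂ) :=
  smulLeftCLM ℂ (fun x : Config n =>
    Complex.exp (((⟪mom z₀, x⟫_ℝ - ⟪mom z₀, pos z₀⟫_ℝ / 2) / ħ : ℝ) * Complex.I)) ∘L
  compSubConstCLM ℂ (pos z₀)

theorem heisenberg_apply (ħ : ℝ) (z₀ : Phase n) (ψ : 𝓢(Config n, ℂ)) (x : Config n) :
    heisenberg ħ z₀ ψ x =
      Complex.exp (((⟪mom z₀, x⟫_ℝ - ⟪mom z₀, pos z₀⟫_ℝ / 2) / ħ : ℝ) * Complex.I) *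
        ψ (x - pos z₀) := by
  have h : (fun x : Config n => (⟪mom z₀, x⟫_ℝ - ⟪mom z₀, pos z₀⟫_ℝ / 2) / ħ).HasTemperateGrowth := by
    simp only [div_eq_mul_inv]
    fun_prop
  rw [heisenberg, ContinuousLinearMap.comp_apply,
    smulLeftCLM_apply_apply (hasTemperateGrowth_cexp_comp h)]
  simp

/-- The first chirp in the factorization of the matrix coefficients of the Heisenberg operators. -/
def chirpIn (z : Phase n) : ℂ := Complex.exp ((2 * π * ⟪mom z, pos z⟫_ℝ : ℝ) * Complex.I)

/-- The second chirp in the factorization of the matrix coefficients of the Heisenberg operators. -/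
def chirpOut (ħ : ℝ) (z : Phase n) : ℂ :=
  Complex.exp ((-(2 * ħ)⁻¹ * ⟪mom z, pos z⟫_ℝ : ℝ) * Complex.I)

theorem chirpIn_growth : (chirpIn (n := n)).HasTemperateGrowth := by
  have := hasTemperateGrowth_mom_pos (n := n)
  exact hasTemperateGrowth_cexp_comp (by fun_prop)

theorem chirpOut_growth (ħ : ℝ) : (chirpOut (n := n) ħ).HasTemperateGrowth := by
  have := hasTemperateGrowth_mom_pos (n := n)
  exact hasTemperateGrowth_cexp_comp (by fun_prop)

/-- The map `F ↦ chirpOut · (𝓕 (chirpIn · F)) ∘ Λ` with `Λ (x, p) = (-p / (2πħ), x)`. -/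
def coeffOp {ħ : ℝ} (hħ : 0 < ħ) : 𝓢(Phase n, ℂ) →L[ℂ] 𝓢(Phase n, ℂ) :=
  smulLeftCLM ℂ (chirpOut ħ) ∘L
    compCLMOfContinuousLinearEquiv ℂ
      (phaseEquiv (-(2 * π * ħ)⁻¹) 1 (by have := Real.pi_pos; simp [hħ.ne', this.ne']) one_ne_zero) ∘L
    fourierCLM ℂ 𝓢(Phase n, ℂ) ∘L smulLeftCLM ℂ chirpIn

theorem coeffOp_apply {ħ : ℝ} (hħ : 0 < ħ) (ψ φ : 𝓢(Config n, ℂ)) (z : Phase n) :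
    coeffOp hħ (tensorRight φ (𝓕 ψ)) z = ∫ x, heisenberg ħ z ψ x * φ x := by
  have hinv : ∀ y, ψ y = ∫ ξ, Complex.exp ((2 * π * ⟪ξ, y⟫_ℝ : ℝ) * Complex.I) * 𝓕 ψ ξ := by
    intro y
    have h : ψ y = 𝓕⁻ (𝓕 ψ) y := by rw [fourierInv_fourier_eq]
    rw [h, fourierInv_coe, Real.fourierInv_eq']
    simp
  rw [coeffOp]
  simp only [ContinuousLinearMap.comp_apply]
  rw [smulLeftCLM_apply_apply (chirpOut_growth ħ), compCLMOfContinuousLinearEquiv_apply,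
    Function.comp_apply, fourierCLM_apply, fourier_coe, Real.fourier_eq', phase_integral]
  set u : Phase n := phaseEquiv (-(2 * π * ħ)⁻¹) 1 (by have := Real.pi_pos; simp [hħ.ne', this.ne'])
    one_ne_zero z with hu
  have hint2 : Integrable (fun q : Config n × Config n =>
      Complex.exp (((-2 * π * ⟪phasePt q.1 q.2, u⟫_ℝ : ℝ) : ℂ) * Complex.I) •
        (smulLeftCLM ℂ chirpIn (tensorRight φ (𝓕 ψ))) (phasePt q.1 q.2)) := by
    have hg : (fun w : Phase n => -2 * π * ⟪w, u⟫_ℝ).HasTemperateGrowth := by fun_prop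
    have := phase_integrable ((smulLeftCLM ℂ (fun w : Phase n => Complex.exp
      (((-2 * π * ⟪w, u⟫_ℝ : ℝ) : ℂ) * Complex.I))
      (smulLeftCLM ℂ chirpIn (tensorRight φ (𝓕 ψ)))).integrable (μ := volume))
    simpa only [smulLeftCLM_apply_apply (hasTemperateGrowth_cexp_comp hg)] using this
  rw [show (volume : Measure (Config n × Config n)) = volume.prod volume from rfl] at hint2 ⊢
  rw [integral_prod _ hint2, smul_eq_mul, ← integral_const_mul]
  congr 1
  ext x
  rw [heisenberg_apply, hinv, ← integral_const_mul, ← integral_const_mul, ← integral_mul_const]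
  congr 1
  ext ξ
  rw [smulLeftCLM_apply_apply chirpIn_growth]
  simp only [tensorRight_apply, chirpIn, chirpOut, pos_phasePt, mom_phasePt, phase_inner, smul_eq_mul]
  rw [← mul_assoc, ← mul_assoc, ← Complex.exp_add, ← mul_assoc, ← Complex.exp_add, ← mul_assoc,
    ← Complex.exp_add, mul_right_comm]
  congr 3
  have hp : (π : ℝ) ≠ 0 := Real.pi_ne_zero
  have hh : ħ ≠ 0 := hħ.ne'
  simp only [hu, phaseEquiv_apply, pos_phasePt, mom_phasePt, one_smul, inner_smul_right,
    inner_sub_right, ← add_mul, ← Complex.ofReal_add]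
  congr 2
  rw [real_inner_comm x (mom z)]
  field_simp
  ring

/-- The matrix coefficient `z ↦ ⟨T̂(z)ψ, φ⟩ = ∫ (T̂(z)ψ)(x) φ(x) dx` (bilinear pairing), which is a
Schwartz function on phase space. -/
def matrixCoeff {ħ : ℝ} (hħ : 0 < ħ) (ψ φ : 𝓢(Config n, ℂ)) : 𝓢(Phase n, ℂ) where
  toFun z := ∫ x, heisenberg ħ z ψ x * φ x
  smooth' := by
    rw [← funext (coeffOp_apply hħ ψ φ)]
    exact (coeffOp hħ (tensorRight φ (𝓕 ψ))).smooth'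
  decay' := by
    rw [← funext (coeffOp_apply hħ ψ φ)]
    exact (coeffOp hħ (tensorRight φ (𝓕 ψ))).decay'

theorem matrixCoeff_apply {ħ : ℝ} (hħ : 0 < ħ) (ψ φ : 𝓢(Config n, ℂ)) (z : Phase n) :
    matrixCoeff hħ ψ φ z = ∫ x, heisenberg ħ z ψ x * φ x := rfl

theorem matrixCoeff_eq {ħ : ℝ} (hħ : 0 < ħ) (ψ φ : 𝓢(Config n, ℂ)) :
    matrixCoeff hħ ψ φ = coeffOp hħ (tensorRight φ (𝓕 ψ)) :=
  SchwartzMap.ext fun z => (coeffOp_apply hħ ψ φ z).symm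

theorem matrixCoeff_eq_right {ħ : ℝ} (hħ : 0 < ħ) (ψ φ : 𝓢(Config n, ℂ)) :
    matrixCoeff hħ ψ φ = (coeffOp hħ ∘L tensorLeft (𝓕 ψ)) φ := by
  rw [matrixCoeff_eq, ContinuousLinearMap.comp_apply, tensorLeft_eq]

theorem matrixCoeff_eq_left {ħ : ℝ} (hħ : 0 < ħ) (ψ φ : 𝓢(Config n, ℂ)) :
    matrixCoeff hħ ψ φ =
      (coeffOp hħ ∘L tensorRight φ ∘L fourierCLM ℂ 𝓢(Config n, ℂ)) ψ := by
  rw [matrixCoeff_eq]; rfl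

/-- The matrix coefficient as a continuous linear function of `φ`. -/
def matrixCoeffCLM {ħ : ℝ} (hħ : 0 < ħ) (ψ : 𝓢(Config n, ℂ)) :
    𝓢(Config n, ℂ) →L[ℂ] 𝓢(Phase n, ℂ) where
  toFun φ := matrixCoeff hħ ψ φ
  map_add' φ χ := by simp only [matrixCoeff_eq_right, map_add]
  map_smul' c φ := by simp only [matrixCoeff_eq_right, map_smul, RingHom.id_apply]
  cont := by
    simp only [matrixCoeff_eq_right]
    exact (coeffOp hħ ∘L tensorLeft (𝓕 ψ)).continuous

/-- `Θ(x, p) = sin (p·x / 2ħ) / (p·x / 2ħ)`, equal to `1` where `p·x = 0`. -/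
def theta (ħ : ℝ) (z : Phase n) : ℂ := (Real.sinc (⟪mom z, pos z⟫_ℝ / (2 * ħ)) : ℝ)

theorem theta_growth (ħ : ℝ) : (theta (n := n) ħ).HasTemperateGrowth := by
  have h := hasTemperateGrowth_mom_pos (n := n)
  have h2 : (fun z : Phase n => ⟪mom z, pos z⟫_ℝ / (2 * ħ)).HasTemperateGrowth := by
    simp only [div_eq_mul_inv]; fun_prop
  exact Function.Complex.hasTemperateGrowth_ofReal.comp (hasTemperateGrowth_sinc.comp h2)

/-- The composition `a ∘ g` of a tempered distribution with a linear automorphism: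
`⟨a ∘ g, φ⟩ = |det g|⁻¹ ⟨a, φ ∘ g⁻¹⟩`. -/
def distComp (a : 𝓢'(Phase n, ℂ)) (g : Phase n ≃L[ℝ] Phase n) : 𝓢'(Phase n, ℂ) :=
  ((|(g : Phase n →L[ℝ] Phase n).det|⁻¹ : ℝ) : ℂ) •
    PointwiseConvergenceCLM.precomp ℂ (compCLMOfContinuousLinearEquiv ℂ g.symm) a

theorem distComp_apply (a : 𝓢'(Phase n, ℂ)) (g : Phase n ≃L[ℝ] Phase n) (φ : 𝓢(Phase n, ℂ)) :
    distComp a g φ = ((|(g : Phase n →L[ℝ] Phase n).det|⁻¹ : ℝ) : ℂ) *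
      a (compCLMOfContinuousLinearEquiv ℂ g.symm φ) := rfl

theorem integral_comp_cle {ι : Type*} [Fintype ι]
    (g : EuclideanSpace ℝ ι ≃L[ℝ] EuclideanSpace ℝ ι) (F : EuclideanSpace ℝ ι → ℂ) :
    ∫ x, F (g x) =
      ((|(g : EuclideanSpace ℝ ι →L[ℝ] EuclideanSpace ℝ ι).det|⁻¹ : ℝ) : ℂ) * ∫ x, F x := by
  have hdet : LinearMap.det (g : EuclideanSpace ℝ ι →ₗ[ℝ] EuclideanSpace ℝ ι) ≠ 0 :=
    (LinearEquiv.isUnit_det' g.toLinearEquiv).ne_zero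
  have h := Measure.map_linearMap_addHaar_eq_smul_addHaar
    (volume : Measure (EuclideanSpace ℝ ι)) hdet
  have h2 := g.toHomeomorph.toMeasurableEquiv.measurableEmbedding.integral_map
    (μ := volume) F
  change ∫ y, F y ∂(Measure.map g volume) = ∫ x, F (g x) at h2
  change Measure.map g volume = _ at h
  rw [← h2, h, integral_smul_measure, ENNReal.toReal_ofReal (abs_nonneg _), abs_inv]
  rfl

/-- For a Schwartz function, `distComp` is composition of functions. -/
theorem distComp_coe (b : 𝓢(Phase n, ℂ)) (g : Phase n ≃L[ℝ] Phase n) :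
    distComp (b : 𝓢'(Phase n, ℂ)) g = (compCLMOfContinuousLinearEquiv ℂ g b : 𝓢(Phase n, ℂ)) := by
  ext φ
  rw [distComp_apply, SchwartzMap.coe_apply, SchwartzMap.coe_apply]
  have h := integral_comp_cle g fun x => φ (g.symm x) * b x
  rw [eq_comm]
  simpa using h

/-- The symplectic form `σ(z, z') = Jz · z' = p · x' - p' · x`. -/
def sympForm (z w : Phase n) : ℝ := ⟪mom z, pos w⟫_ℝ - ⟪mom w, pos z⟫_ℝ

theorem two_pi_hbar_inv_ne {ħ : ℝ} (hħ : 0 < ħ) : (2 * π * ħ)⁻¹ ≠ 0 := by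
  have := Real.pi_pos
  positivity

/-- The automorphism `z ↦ (2πħ)⁻¹ J z`, `J (x, p) = (p, -x)`, of phase space. -/
def scaledJ {ħ : ℝ} (hħ : 0 < ħ) : Phase n ≃L[ℝ] Phase n :=
  phaseEquiv (2 * π * ħ)⁻¹ (-(2 * π * ħ)⁻¹) (two_pi_hbar_inv_ne hħ)
    (neg_ne_zero.2 (two_pi_hbar_inv_ne hħ))

/-- The symplectic Fourier transform
`a_σ(z) = (2πħ)⁻ⁿ ∫ exp(-(i/ħ)σ(z,z')) a(z') dz' = (2πħ)⁻ⁿ (𝓕 a)((2πħ)⁻¹ J z)` on tempered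
distributions; here `(𝓕 a)(w) = ∫ exp(-2πi w·z') a(z') dz'`. -/
def sympFourier {ħ : ℝ} (hħ : 0 < ħ) (a : 𝓢'(Phase n, ℂ)) : 𝓢'(Phase n, ℂ) :=
  (((1 / (2 * π * ħ)) ^ n : ℝ) : ℂ) • distComp (𝓕 a) (scaledJ hħ)

/-- On Schwartz functions the symplectic Fourier transform is given by its integral formula. -/
theorem sympFourier_coe {ħ : ℝ} (hħ : 0 < ħ) (b φ : 𝓢(Phase n, ℂ)) :
    sympFourier hħ (b : 𝓢'(Phase n, ℂ)) φ =
      ∫ z, φ z * ((((1 / (2 * π * ħ)) ^ n : ℝ) : ℂ) *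
        ∫ w, Complex.exp ((-sympForm z w / ħ : ℝ) * Complex.I) * b w) := by
  rw [sympFourier, TemperedDistribution.fourier_toTemperedDistributionCLM_eq, distComp_coe]
  change (((1 / (2 * π * ħ)) ^ n : ℝ) : ℂ) • ((compCLMOfContinuousLinearEquiv ℂ (scaledJ hħ) (𝓕 b) : 𝓢(Phase n, ℂ)) :
    𝓢'(Phase n, ℂ)) φ = _
  rw [SchwartzMap.coe_apply, ← integral_smul]
  congr 1
  ext z
  simp only [smul_eq_mul, compCLMOfContinuousLinearEquiv_apply, Function.comp_apply]
  rw [fourier_coe, Real.fourier_eq']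
  rw [mul_left_comm]
  congr 3
  ext w
  rw [smul_eq_mul]
  congr 4
  have hp : (π : ℝ) ≠ 0 := Real.pi_ne_zero
  have hh : ħ ≠ 0 := hħ.ne'
  simp only [scaledJ, phaseEquiv_apply, phase_inner, pos_phasePt, mom_phasePt, sympForm,
    inner_smul_right]
  rw [real_inner_comm (mom z)]
  field_simp
  ring

/-- The Born–Jordan operator `Op_BJ(a) : 𝓢(ℝⁿ) → 𝓢'(ℝⁿ)` with symbol `a ∈ 𝓢'(ℝ²ⁿ)`,
`Op_BJ(a)ψ = (2πħ)⁻ⁿ ∫ a_σ(z) Θ(z) T̂(z)ψ dz`, the integral being understood weakly: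
`⟨Op_BJ(a)ψ, φ⟩ = (2πħ)⁻ⁿ ⟨Θ a_σ, z ↦ ⟨T̂(z)ψ, φ⟩⟩`. -/
def opBJ {ħ : ℝ} (hħ : 0 < ħ) (a : 𝓢'(Phase n, ℂ)) : 𝓢(Config n, ℂ) →L[ℂ] 𝓢'(Config n, ℂ) where
  toFun ψ := (((1 / (2 * π * ħ)) ^ n : ℝ) : ℂ) •
    PointwiseConvergenceCLM.precomp ℂ (matrixCoeffCLM hħ ψ)
      (TemperedDistribution.smulLeftCLM ℂ (theta ħ) (sympFourier hħ a))
  map_add' ψ χ := by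
    ext φ
    have h : matrixCoeff hħ (ψ + χ) φ = matrixCoeff hħ ψ φ + matrixCoeff hħ χ φ := by
      simp only [matrixCoeff_eq_left, map_add]
    change _ * sympFourier hħ a (smulLeftCLM ℂ (theta ħ) (matrixCoeff hħ (ψ + χ) φ)) =
      _ * sympFourier hħ a (smulLeftCLM ℂ (theta ħ) (matrixCoeff hħ ψ φ)) +
      _ * sympFourier hħ a (smulLeftCLM ℂ (theta ħ) (matrixCoeff hħ χ φ))
    rw [h, map_add, map_add, mul_add]
  map_smul' c ψ := by
    ext φ
    have h : matrixCoeff hħ (c • ψ) φ = c • matrixCoeff hħ ψ φ := by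
      simp only [matrixCoeff_eq_left, map_smul]
    change _ * sympFourier hħ a (smulLeftCLM ℂ (theta ħ) (matrixCoeff hħ (c • ψ) φ)) =
      c * (_ * sympFourier hħ a (smulLeftCLM ℂ (theta ħ) (matrixCoeff hħ ψ φ)))
    rw [h, map_smul, map_smul, smul_eq_mul, mul_left_comm]
  cont := by
    refine PointwiseConvergenceCLM.continuous_of_continuous_eval fun φ => ?_
    change Continuous fun ψ => (((1 / (2 * π * ħ)) ^ n : ℝ) : ℂ) *
      sympFourier hħ a (smulLeftCLM ℂ (theta ħ) (matrixCoeff hħ ψ φ))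
    simp only [matrixCoeff_eq_left]
    exact continuous_const.mul ((sympFourier hħ a).continuous.comp
      ((smulLeftCLM ℂ (theta ħ)).continuous.comp (ContinuousLinearMap.continuous _)))

theorem opBJ_apply {ħ : ℝ} (hħ : 0 < ħ) (a : 𝓢'(Phase n, ℂ)) (ψ φ : 𝓢(Config n, ℂ)) :
    opBJ hħ a ψ φ = (((1 / (2 * π * ħ)) ^ n : ℝ) : ℂ) *
      sympFourier hħ a (smulLeftCLM ℂ (theta ħ) (matrixCoeff hħ ψ φ)) := rfl

/-- The action of a symplectic matrix on phase space. -/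
def sympEquiv : Matrix.symplecticGroup (Fin n) ℝ →* (Phase n ≃L[ℝ] Phase n) :=
  (ContinuousLinearEquiv.unitsEquiv ℝ (Phase n)).toMonoidHom.comp
    (MonoidHom.toHomUnits
      (((Matrix.toEuclideanCLM (n := Fin n ⊕ Fin n) (𝕜 := ℝ) : _ →* _)).comp
        (Matrix.symplecticGroup (Fin n) ℝ).subtype))

theorem sympEquiv_apply (s : Matrix.symplecticGroup (Fin n) ℝ) (z : Phase n) :
    sympEquiv s z = WithLp.toLp 2 ((s : Matrix _ _ ℝ) *ᵥ z.ofLp) := rfl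

/-- The action of an invertible matrix on configuration space. -/
def glEquiv (L : GL (Fin n) ℝ) : Config n ≃L[ℝ] Config n :=
  ContinuousLinearEquiv.unitsEquiv ℝ (Config n)
    (Units.map (Matrix.toEuclideanCLM (n := Fin n) (𝕜 := ℝ) : _ →* _) L)

theorem glEquiv_apply (L : GL (Fin n) ℝ) (x : Config n) :
    glEquiv L x = WithLp.toLp 2 ((L : Matrix _ _ ℝ) *ᵥ x.ofLp) := rfl

/-- `J = (0, I; -I, 0)`, that is `J (x, p) = (p, -x)`. -/
def sympJ (n : ℕ) : Matrix.symplecticGroup (Fin n) ℝ :=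
  ⟨Matrix.fromBlocks 0 1 (-1) 0, SymplecticGroup.fromBlocks_mem_iff.2 (by simp)⟩

/-- `M_L = (L⁻¹, 0; 0, Lᵀ)`. -/
def sympM (L : GL (Fin n) ℝ) : Matrix.symplecticGroup (Fin n) ℝ :=
  ⟨Matrix.fromBlocks (L⁻¹ : GL (Fin n) ℝ) 0 0 (L : Matrix (Fin n) (Fin n) ℝ)ᵀ,
    SymplecticGroup.fromBlocks_mem_iff.2 (by
      simp [← Matrix.transpose_mul])⟩

/-- `V_P = (I, 0; -P, I)` for a symmetric matrix `P`. -/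
def sympV (P : Matrix (Fin n) (Fin n) ℝ) (hP : P.IsSymm) : Matrix.symplecticGroup (Fin n) ℝ :=
  ⟨Matrix.fromBlocks 1 0 (-P) 1, SymplecticGroup.fromBlocks_mem_iff.2 (by simp [hP.eq])⟩

theorem pos_sympJ (z : Phase n) : pos (sympEquiv (sympJ n) z) = mom z := by
  ext i; simp [sympEquiv_apply, sympJ, Matrix.fromBlocks_mulVec]

theorem mom_sympJ (z : Phase n) : mom (sympEquiv (sympJ n) z) = -pos z := by
  ext i; simp [sympEquiv_apply, sympJ, Matrix.fromBlocks_mulVec, Matrix.neg_mulVec]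

theorem pos_sympM (L : GL (Fin n) ℝ) (z : Phase n) :
    pos (sympEquiv (sympM L) z) = (glEquiv L).symm (pos z) := by
  rw [ContinuousLinearEquiv.eq_symm_apply]
  ext i
  have : (L : Matrix (Fin n) (Fin n) ℝ) *ᵥ (((L⁻¹ : GL (Fin n) ℝ) : Matrix (Fin n) (Fin n) ℝ) *ᵥ
    (pos z).ofLp) = (pos z).ofLp := by
    simp [Matrix.mulVec_mulVec]
  have h : (pos (sympEquiv (sympM L) z)).ofLp =
      ((L⁻¹ : GL (Fin n) ℝ) : Matrix (Fin n) (Fin n) ℝ) *ᵥ (pos z).ofLp := by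
    ext i
    simp [sympEquiv_apply, sympM, Matrix.fromBlocks_mulVec]
    rfl
  rw [← congrFun this i, glEquiv_apply, h]

theorem inner_mom_sympM (L : GL (Fin n) ℝ) (z : Phase n) (x : Config n) :
    ⟪mom (sympEquiv (sympM L) z), x⟫_ℝ = ⟪mom z, glEquiv L x⟫_ℝ := by
  have h : (mom (sympEquiv (sympM L) z)).ofLp =
      (L : Matrix (Fin n) (Fin n) ℝ)ᵀ *ᵥ (mom z).ofLp := by
    ext i
    simp [sympEquiv_apply, sympM, Matrix.fromBlocks_mulVec]
    rfl
  rw [EuclideanSpace.inner_eq_star_dotProduct, EuclideanSpace.inner_eq_star_dotProduct, h,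
    glEquiv_apply]
  simp only [Matrix.mulVec_transpose, star_trivial]
  rw [dotProduct_comm, ← Matrix.dotProduct_mulVec, dotProduct_comm]

theorem pos_sympV (P : Matrix (Fin n) (Fin n) ℝ) (hP : P.IsSymm) (z : Phase n) :
    pos (sympEquiv (sympV P hP) z) = pos z := by
  ext i; simp [sympEquiv_apply, sympV, Matrix.fromBlocks_mulVec]

theorem mom_sympV (P : Matrix (Fin n) (Fin n) ℝ) (hP : P.IsSymm) (z : Phase n) :
    mom (sympEquiv (sympV P hP) z) = mom z - Matrix.toEuclideanCLM (𝕜 := ℝ) P (pos z) := by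
  ext i; simp [sympEquiv_apply, sympV, Matrix.fromBlocks_mulVec, Matrix.neg_mulVec]
  rw [add_comm, sub_eq_add_neg]; rfl

/-- Composition with a linear automorphism, `ψ ↦ ψ ∘ g`. -/
def compCLE (g : Config n ≃L[ℝ] Config n) : 𝓢(Config n, ℂ) ≃L[ℂ] 𝓢(Config n, ℂ) :=
  ContinuousLinearEquiv.equivOfInverse (compCLMOfContinuousLinearEquiv ℂ g)
    (compCLMOfContinuousLinearEquiv ℂ g.symm)
    (fun ψ => by ext x; simp) (fun ψ => by ext x; simp)

/-- Multiplication by the unimodular function `exp(i f)`. -/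
def mulCLE (f : Config n → ℝ) (hf : f.HasTemperateGrowth) :
    𝓢(Config n, ℂ) ≃L[ℂ] 𝓢(Config n, ℂ) :=
  ContinuousLinearEquiv.equivOfInverse
    (smulLeftCLM ℂ fun x => Complex.exp (((f x : ℝ) : ℂ) * Complex.I))
    (smulLeftCLM ℂ fun x => Complex.exp (((-f x : ℝ) : ℂ) * Complex.I))
    (fun ψ => by
      ext x
      rw [smulLeftCLM_apply_apply (hasTemperateGrowth_cexp_comp (f := fun x => -f x) hf.neg),
        smulLeftCLM_apply_apply (hasTemperateGrowth_cexp_comp hf), smul_smul, ← Complex.exp_add]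
      simp)
    (fun ψ => by
      ext x
      rw [smulLeftCLM_apply_apply (hasTemperateGrowth_cexp_comp hf),
        smulLeftCLM_apply_apply (hasTemperateGrowth_cexp_comp (f := fun x => -f x) hf.neg), smul_smul,
        ← Complex.exp_add]
      simp)

/-- Multiplication by a nonzero constant. -/
def scalarCLE (c : ℂ) (hc : c ≠ 0) : 𝓢(Config n, ℂ) ≃L[ℂ] 𝓢(Config n, ℂ) :=
  ContinuousLinearEquiv.smulLeft (Units.mk0 c hc)

@[simp] theorem compCLE_apply (g : Config n ≃L[ℝ] Config n) (ψ : 𝓢(Config n, ℂ)) (x : Config n) :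
    compCLE g ψ x = ψ (g x) := rfl

@[simp] theorem mulCLE_apply (f : Config n → ℝ) (hf : f.HasTemperateGrowth) (ψ : 𝓢(Config n, ℂ))
    (x : Config n) : mulCLE f hf ψ x = Complex.exp (((f x : ℝ) : ℂ) * Complex.I) * ψ x :=
  smulLeftCLM_apply_apply (hasTemperateGrowth_cexp_comp hf) ψ x

@[simp] theorem scalarCLE_apply (c : ℂ) (hc : c ≠ 0) (ψ : 𝓢(Config n, ℂ)) (x : Config n) :
    scalarCLE c hc ψ x = c * ψ x := rfl

/-- The dilation `x ↦ (2πħ)⁻¹ x`. -/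
def dilation {ħ : ℝ} (hħ : 0 < ħ) : Config n ≃L[ℝ] Config n :=
  ContinuousLinearEquiv.smulLeft (Units.mk0 _ (two_pi_hbar_inv_ne hħ))

@[simp] theorem dilation_apply {ħ : ℝ} (hħ : 0 < ħ) (x : Config n) :
    dilation hħ x = (2 * π * ħ)⁻¹ • x := rfl

theorem JHat_const_ne {ħ : ℝ} (hħ : 0 < ħ) :
    Complex.exp (((-(n * π / 4) : ℝ) : ℂ) * Complex.I) * (((2 * π * ħ) ^ (-(n : ℝ) / 2) : ℝ) : ℂ) ≠ 0 := by
  have : (0 : ℝ) < (2 * π * ħ) ^ (-(n : ℝ) / 2) := by positivity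
  exact mul_ne_zero (Complex.exp_ne_zero _) (by exact_mod_cast this.ne')

/-- `Ĵ = e^{-inπ/4} F`, where `F ψ(ξ) = (2πħ)^{-n/2} ∫ exp(-(i/ħ) ξ·x) ψ(x) dx`
(see `JHat_apply`). -/
def JHat {ħ : ℝ} (hħ : 0 < ħ) : 𝓢(Config n, ℂ) ≃L[ℂ] 𝓢(Config n, ℂ) :=
  scalarCLE _ (JHat_const_ne (n := n) hħ) * compCLE (dilation hħ) * fourierCLE ℂ 𝓢(Config n, ℂ)

theorem JHat_apply {ħ : ℝ} (hħ : 0 < ħ) (ψ : 𝓢(Config n, ℂ)) (ξ : Config n) :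
    JHat hħ ψ ξ = Complex.exp (((-(n * π / 4) : ℝ) : ℂ) * Complex.I) *
      (((2 * π * ħ) ^ (-(n : ℝ) / 2) : ℝ) : ℂ) *
        ∫ x, Complex.exp (((-⟪ξ, x⟫_ℝ / ħ : ℝ) : ℂ) * Complex.I) * ψ x := by
  have h1 : JHat hħ ψ ξ = Complex.exp (((-(n * π / 4) : ℝ) : ℂ) * Complex.I) *
      (((2 * π * ħ) ^ (-(n : ℝ) / 2) : ℝ) : ℂ) * 𝓕 ψ ((2 * π * ħ)⁻¹ • ξ) := rfl
  rw [h1, fourier_coe, Real.fourier_eq']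
  congr 2
  ext x
  rw [smul_eq_mul]
  congr 4
  have hp : (π : ℝ) ≠ 0 := Real.pi_ne_zero
  have hh : ħ ≠ 0 := hħ.ne'
  rw [inner_smul_right, real_inner_comm]
  field_simp

theorem MHat_const_ne (L : GL (Fin n) ℝ) (m : ℤ) :
    Complex.I ^ m * ((√|(L : Matrix (Fin n) (Fin n) ℝ).det| : ℝ) : ℂ) ≠ 0 := by
  have h : (L : Matrix (Fin n) (Fin n) ℝ).det ≠ 0 :=
    ((Matrix.isUnit_iff_isUnit_det _).1 L.isUnit).ne_zero
  exact mul_ne_zero (zpow_ne_zero _ Complex.I_ne_zero)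
    (by exact_mod_cast (Real.sqrt_pos.2 (abs_pos.2 h)).ne')

/-- `(M̂_{L,m} ψ)(x) = i^m √|det L| ψ(Lx)`. -/
def MHat (L : GL (Fin n) ℝ) (m : ℤ) : 𝓢(Config n, ℂ) ≃L[ℂ] 𝓢(Config n, ℂ) :=
  scalarCLE _ (MHat_const_ne L m) * compCLE (glEquiv L)

theorem MHat_apply (L : GL (Fin n) ℝ) (m : ℤ) (ψ : 𝓢(Config n, ℂ)) (x : Config n) :
    MHat L m ψ x = Complex.I ^ m * ((√|(L : Matrix (Fin n) (Fin n) ℝ).det| : ℝ) : ℂ) *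
      ψ (glEquiv L x) := rfl

theorem quadForm_growth (ħ : ℝ) (P : Matrix (Fin n) (Fin n) ℝ) :
    (fun x : Config n =>
      -(⟪Matrix.toEuclideanCLM (𝕜 := ℝ) P x, x⟫_ℝ / (2 * ħ))).HasTemperateGrowth := by
  have := ContinuousLinearMap.bilinear_hasTemperateGrowth (𝕜 := ℝ) (innerSL ℝ (E := Config n))
    (f := fun x : Config n => Matrix.toEuclideanCLM (𝕜 := ℝ) P x) (g := fun x => x)
    (ContinuousLinearMap.hasTemperateGrowth _) (by fun_prop)
  have h2 : (fun x : Config n =>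
    ⟪Matrix.toEuclideanCLM (𝕜 := ℝ) P x, x⟫_ℝ).HasTemperateGrowth := this
  simp only [div_eq_mul_inv]
  fun_prop

/-- `(V̂_P ψ)(x) = exp(-(i/2ħ) Px·x) ψ(x)`. -/
def VHat (ħ : ℝ) (P : Matrix (Fin n) (Fin n) ℝ) : 𝓢(Config n, ℂ) ≃L[ℂ] 𝓢(Config n, ℂ) :=
  mulCLE _ (quadForm_growth ħ P)

theorem VHat_apply (ħ : ℝ) (P : Matrix (Fin n) (Fin n) ℝ) (ψ : 𝓢(Config n, ℂ)) (x : Config n) :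
    VHat ħ P ψ x =
      Complex.exp (((-(⟪Matrix.toEuclideanCLM (𝕜 := ℝ) P x, x⟫_ℝ / (2 * ħ)) : ℝ) : ℂ) *
        Complex.I) * ψ x :=
  mulCLE_apply _ (quadForm_growth ħ P) ψ x

/-- `mπ` is an argument of `det L`. -/
def IsDetArg (L : GL (Fin n) ℝ) (m : ℤ) : Prop :=
  (((L : Matrix (Fin n) (Fin n) ℝ).det : ℝ) : ℂ) =
    (|(L : Matrix (Fin n) (Fin n) ℝ).det| : ℝ) * Complex.exp (((m * π : ℝ) : ℂ) * Complex.I)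

theorem JHat_heisenberg {ħ : ℝ} (hħ : 0 < ħ) (z : Phase n) (ψ : 𝓢(Config n, ℂ)) :
    JHat hħ (heisenberg ħ z ψ) = heisenberg ħ (sympEquiv (sympJ n) z) (JHat hħ ψ) := by
  ext ξ
  rw [heisenberg_apply, JHat_apply, JHat_apply, pos_sympJ, mom_sympJ,
    ← integral_add_right_eq_self _ (pos z), mul_left_comm]
  congr 1
  rw [← integral_const_mul]
  congr 1
  ext x
  rw [heisenberg_apply, add_sub_cancel_right, ← mul_assoc, ← mul_assoc, ← Complex.exp_add,
    ← Complex.exp_add, ← add_mul, ← add_mul, ← Complex.ofReal_add, ← Complex.ofReal_add]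
  congr 4
  simp only [inner_add_right, inner_sub_left, inner_neg_left]
  rw [real_inner_comm (pos z) ξ, real_inner_comm (mom z) (pos z)]
  ring

theorem MHat_heisenberg (ħ : ℝ) (L : GL (Fin n) ℝ) (m : ℤ) (z : Phase n) (ψ : 𝓢(Config n, ℂ)) :
    MHat L m (heisenberg ħ z ψ) = heisenberg ħ (sympEquiv (sympM L) z) (MHat L m ψ) := by
  ext x
  rw [heisenberg_apply, MHat_apply, MHat_apply, heisenberg_apply, pos_sympM, inner_mom_sympM,
    inner_mom_sympM, map_sub (glEquiv L), ContinuousLinearEquiv.apply_symm_apply]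
  ring

theorem VHat_heisenberg (ħ : ℝ) (P : Matrix (Fin n) (Fin n) ℝ) (hP : P.IsSymm) (z : Phase n)
    (ψ : 𝓢(Config n, ℂ)) :
    VHat ħ P (heisenberg ħ z ψ) = heisenberg ħ (sympEquiv (sympV P hP) z) (VHat ħ P ψ) := by
  ext x
  rw [heisenberg_apply, VHat_apply, VHat_apply, heisenberg_apply, pos_sympV, mom_sympV,
    ← mul_assoc, ← mul_assoc, ← Complex.exp_add, ← Complex.exp_add, ← add_mul, ← add_mul,
    ← Complex.ofReal_add, ← Complex.ofReal_add]
  congr 4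
  have hs : ⟪Matrix.toEuclideanCLM (𝕜 := ℝ) P x, pos z⟫_ℝ =
      ⟪Matrix.toEuclideanCLM (𝕜 := ℝ) P (pos z), x⟫_ℝ := by
    rw [EuclideanSpace.inner_eq_star_dotProduct, EuclideanSpace.inner_eq_star_dotProduct]
    simp only [Matrix.ofLp_toEuclideanCLM, star_trivial]
    rw [Matrix.dotProduct_mulVec, ← Matrix.mulVec_transpose, hP.eq, dotProduct_comm]
  simp only [inner_sub_left, inner_sub_right, map_sub, hs]
  ring

theorem cle_mul_apply {R M : Type*} [Semiring R] [TopologicalSpace M] [AddCommMonoid M] [Module R M]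
    (f g : M ≃L[R] M) (x : M) : (f * g) x = f (g x) := rfl

theorem cle_apply_inv {R M : Type*} [Semiring R] [TopologicalSpace M] [AddCommMonoid M]
    [Module R M] (f : M ≃L[R] M) (x : M) : f (f⁻¹ x) = x := f.apply_symm_apply x

theorem cle_inv_apply {R M : Type*} [Semiring R] [TopologicalSpace M] [AddCommMonoid M]
    [Module R M] (f : M ≃L[R] M) (x : M) : f⁻¹ (f x) = x := f.symm_apply_apply x

/-- The generators of the metaplectic group together with their projections to the symplectic
group: `(Ĵ, J)`, `(M̂_{L,m}, M_L)` and `(V̂_P, V_P)`. -/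
inductive MpGenerator {ħ : ℝ} (hħ : 0 < ħ) :
    (𝓢(Config n, ℂ) ≃L[ℂ] 𝓢(Config n, ℂ)) × Matrix.symplecticGroup (Fin n) ℝ → Prop
  | J : MpGenerator hħ (JHat hħ, sympJ n)
  | M (L : GL (Fin n) ℝ) (m : ℤ) (hm : IsDetArg L m) : MpGenerator hħ (MHat L m, sympM L)
  | V (P : Matrix (Fin n) (Fin n) ℝ) (hP : P.IsSymm) : MpGenerator hħ (VHat ħ P, sympV P hP)

/-- The metaplectic group `Mp(2n, ℝ)`, generated by the operators `Ĵ`, `M̂_{L,m}` and `V̂_P`. Its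
elements are unitary operators on `L²(ℝⁿ)`; they are given here by their restrictions to the dense
invariant subspace `𝓢(ℝⁿ)`, on which they are automorphisms (see `Mp_unitary`). -/
def Mp (n : ℕ) {ħ : ℝ} (hħ : 0 < ħ) : Subgroup (𝓢(Config n, ℂ) ≃L[ℂ] 𝓢(Config n, ℂ)) :=
  Subgroup.closure (Prod.fst '' {g | MpGenerator (n := n) hħ g})

/-- The graph of the projection of the metaplectic group onto the symplectic group. -/
def mpGraph (n : ℕ) {ħ : ℝ} (hħ : 0 < ħ) :
    Subgroup ((𝓢(Config n, ℂ) ≃L[ℂ] 𝓢(Config n, ℂ)) × Matrix.symplecticGroup (Fin n) ℝ) :=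
  Subgroup.closure {g | MpGenerator (n := n) hħ g}

theorem mpGraph_heisenberg {ħ : ℝ} (hħ : 0 < ħ) {g} (hg : g ∈ mpGraph n hħ) :
    ∀ (z : Phase n) (ψ : 𝓢(Config n, ℂ)),
      g.1 (heisenberg ħ z ψ) = heisenberg ħ (sympEquiv g.2 z) (g.1 ψ) := by
  induction hg using Subgroup.closure_induction with
  | mem g hg =>
    intro z ψ
    cases hg with
    | J => exact JHat_heisenberg hħ z ψ
    | M L m hm => exact MHat_heisenberg ħ L m z ψ
    | V P hP => exact VHat_heisenberg ħ P hP z ψ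
  | one => intro z ψ; rw [Prod.snd_one, map_one]; rfl
  | mul g h _ _ hg hh =>
    intro z ψ
    simp only [Prod.fst_mul, Prod.snd_mul, map_mul, cle_mul_apply, hh, hg]
  | inv g _ hg =>
    intro z ψ
    have h := hg ((sympEquiv g.2)⁻¹ z) (g.1⁻¹ ψ)
    rw [cle_apply_inv, cle_apply_inv] at h
    rw [Prod.fst_inv, Prod.snd_inv, map_inv, ← h, cle_inv_apply]

theorem heisenberg_injective {ħ : ℝ} (hħ : 0 < ħ) {z w : Phase n}
    (h : ∀ ψ, heisenberg ħ z ψ = heisenberg ħ w ψ) : z = w := by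
  have bump : ∀ (c : Config n) (r : ℝ), 0 < r → ∃ ψ : 𝓢(Config n, ℂ), ψ c ≠ 0 ∧
      ∀ d, r ≤ dist d c → ψ d = 0 := by
    intro c r hr
    let f : ContDiffBump c := ⟨r / 2, r, by positivity, by linarith⟩
    have h1 : HasCompactSupport (fun x => (f x : ℂ)) :=
      f.hasCompactSupport.comp_left (g := Complex.ofReal) Complex.ofReal_zero
    have h2 : ContDiff ℝ ∞ (fun x => (f x : ℂ)) := Complex.ofRealCLM.contDiff.comp f.contDiff
    refine ⟨h1.toSchwartzMap h2, ?_, fun d hd => ?_⟩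
    · change (f c : ℂ) ≠ 0
      rw [f.one_of_mem_closedBall (Metric.mem_closedBall_self f.rIn_pos.le)]
      simp
    · change (f d : ℂ) = 0
      rw [f.zero_of_le_dist hd]
      simp
  have hpos : pos z = pos w := by
    by_contra hne
    obtain ⟨ψ, h0, h1⟩ := bump 0 (dist (pos z - pos w) 0)
      (dist_pos.2 (sub_ne_zero.2 hne))
    have := congrArg (fun φ : 𝓢(Config n, ℂ) => φ (pos z)) (h ψ)
    simp only [heisenberg_apply, sub_self, h1 _ le_rfl, mul_zero] at this
    exact (mul_ne_zero (Complex.exp_ne_zero _) h0) this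
  refine phase_ext hpos ?_
  have hphase : ∀ x : Config n,
      Complex.exp (((⟪mom z - mom w, x - (2⁻¹ : ℝ) • pos z⟫_ℝ) / ħ : ℝ) * Complex.I) = 1 := by
    intro x
    obtain ⟨ψ, h0⟩ : ∃ ψ : 𝓢(Config n, ℂ), ψ (x - pos z) ≠ 0 := by
      obtain ⟨ψ, h0, _⟩ := bump (x - pos z) 1 one_pos
      exact ⟨ψ, h0⟩
    have := congrArg (fun φ : 𝓢(Config n, ℂ) => φ x) (h ψ)
    simp only [heisenberg_apply, ← hpos] at this
    have h2 := mul_right_cancel₀ h0 this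
    rw [← div_eq_one_iff_eq (Complex.exp_ne_zero _), ← Complex.exp_sub, ← sub_mul,
      ← Complex.ofReal_sub] at h2
    rw [← h2]
    congr 3
    simp only [inner_sub_left, inner_sub_right, inner_smul_right]
    ring
  by_contra hne
  set v := mom z - mom w with hv
  have hv0 : v ≠ 0 := sub_ne_zero.2 hne
  have hvv : 0 < ⟪v, v⟫_ℝ := real_inner_self_pos.2 hv0
  have h1 := hphase ((2⁻¹ : ℝ) • pos z + (ħ / ⟪v, v⟫_ℝ) • v)
  rw [add_sub_cancel_left, inner_smul_right, div_mul_cancel₀ _ hvv.ne', div_self hħ.ne',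
    Complex.exp_eq_one_iff] at h1
  obtain ⟨k, hk⟩ := h1
  have h3 := congrArg Complex.im hk
  simp at h3
  have hp := Real.pi_gt_three
  rcases lt_trichotomy k 0 with hk | rfl | hk
  · have : (k : ℝ) ≤ -1 := by exact_mod_cast (by omega : k ≤ -1)
    nlinarith
  · simp at h3
  · have : (1 : ℝ) ≤ k := by exact_mod_cast (by omega : 1 ≤ k)
    nlinarith

theorem sympEquiv_injective : Function.Injective (sympEquiv (n := n)) := by
  intro s t h
  apply Subtype.ext
  apply (Matrix.toEuclideanCLM (n := Fin n ⊕ Fin n) (𝕜 := ℝ)).injective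
  ext1 z
  exact congrArg (fun g : Phase n ≃L[ℝ] Phase n => g z) h

theorem mpGraph_unique {ħ : ℝ} (hħ : 0 < ħ) {B : 𝓢(Config n, ℂ) ≃L[ℂ] 𝓢(Config n, ℂ)}
    {s t : Matrix.symplecticGroup (Fin n) ℝ} (hs : (B, s) ∈ mpGraph n hħ)
    (ht : (B, t) ∈ mpGraph n hħ) : s = t := by
  apply sympEquiv_injective
  ext1
  funext z
  refine heisenberg_injective hħ fun ψ => ?_
  have h1 := mpGraph_heisenberg hħ hs z (B⁻¹ ψ)
  have h2 := mpGraph_heisenberg hħ ht z (B⁻¹ ψ)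
  simp only [cle_apply_inv] at h1 h2
  rw [← h1, h2]

theorem mpGraph_exists {ħ : ℝ} (hħ : 0 < ħ) (B : Mp n hħ) :
    ∃ s, ((B : 𝓢(Config n, ℂ) ≃L[ℂ] 𝓢(Config n, ℂ)), s) ∈ mpGraph n hħ := by
  have h : (B : 𝓢(Config n, ℂ) ≃L[ℂ] 𝓢(Config n, ℂ)) ∈
      (mpGraph n hħ).map (MonoidHom.fst _ _) := by
    rw [mpGraph, MonoidHom.map_closure]
    exact B.2
  obtain ⟨⟨C, s⟩, hg, rfl : C = B⟩ := h
  exact ⟨s, hg⟩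

/-- The projection `π^Mp : Mp(2n, ℝ) → Sp(2n, ℝ)`: the group homomorphism with `Ĵ ↦ J`,
`M̂_{L,m} ↦ M_L` and `V̂_P ↦ V_P`. -/
def projMp {ħ : ℝ} (hħ : 0 < ħ) : Mp n hħ →* Matrix.symplecticGroup (Fin n) ℝ :=
  MonoidHom.mk' (fun B => (mpGraph_exists hħ B).choose) fun A B =>
    mpGraph_unique hħ (mpGraph_exists hħ (A * B)).choose_spec
      ((mpGraph n hħ).mul_mem (mpGraph_exists hħ A).choose_spec (mpGraph_exists hħ B).choose_spec)

namespace Mp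

/-- `Ĵ` as an element of the metaplectic group. -/
def J (n : ℕ) {ħ : ℝ} (hħ : 0 < ħ) : Mp n hħ :=
  ⟨JHat hħ, Subgroup.subset_closure ⟨_, MpGenerator.J, rfl⟩⟩

/-- `M̂_{L,m}` as an element of the metaplectic group. -/
def M {ħ : ℝ} (hħ : 0 < ħ) (L : GL (Fin n) ℝ) (m : ℤ) (hm : IsDetArg L m) : Mp n hħ :=
  ⟨MHat L m, Subgroup.subset_closure ⟨_, MpGenerator.M L m hm, rfl⟩⟩

/-- `V̂_P` as an element of the metaplectic group. -/
def V {ħ : ℝ} (hħ : 0 < ħ) (P : Matrix (Fin n) (Fin n) ℝ) (hP : P.IsSymm) : Mp n hħ :=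
  ⟨VHat ħ P, Subgroup.subset_closure ⟨_, MpGenerator.V P hP, rfl⟩⟩

end Mp

theorem projMp_J {ħ : ℝ} (hħ : 0 < ħ) : projMp hħ (Mp.J n hħ) = sympJ n :=
  mpGraph_unique hħ (mpGraph_exists hħ _).choose_spec (Subgroup.subset_closure MpGenerator.J)

theorem projMp_M {ħ : ℝ} (hħ : 0 < ħ) (L : GL (Fin n) ℝ) (m : ℤ) (hm : IsDetArg L m) :
    projMp hħ (Mp.M hħ L m hm) = sympM L :=
  mpGraph_unique hħ (mpGraph_exists hħ _).choose_spec
    (Subgroup.subset_closure (MpGenerator.M L m hm))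

theorem projMp_V {ħ : ℝ} (hħ : 0 < ħ) (P : Matrix (Fin n) (Fin n) ℝ) (hP : P.IsSymm) :
    projMp hħ (Mp.V hħ P hP) = sympV P hP :=
  mpGraph_unique hħ (mpGraph_exists hħ _).choose_spec
    (Subgroup.subset_closure (MpGenerator.V P hP))

theorem Mp_heisenberg {ħ : ℝ} (hħ : 0 < ħ) (S : Mp n hħ) (z : Phase n) (ψ : 𝓢(Config n, ℂ)) :
    S.1 (heisenberg ħ z ψ) = heisenberg ħ (sympEquiv (projMp hħ S) z) (S.1 ψ) :=
  mpGraph_heisenberg hħ (mpGraph_exists hħ S).choose_spec z ψ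

/-- The subgroup of the metaplectic group generated by `Ĵ` and the `M̂_{L,m}`. -/
def mpBJ (n : ℕ) {ħ : ℝ} (hħ : 0 < ħ) : Subgroup (Mp n hħ) :=
  Subgroup.closure ({Mp.J n hħ} ∪ {S | ∃ L m hm, S = Mp.M hħ L m hm})

theorem conj_mul_mul (c a b : ℂ) :
    conj (c * a) * (c * b) = ((‖c‖ ^ 2 : ℝ) : ℂ) * (conj a * b) := by
  rw [map_mul, mul_mul_mul_comm, Complex.conj_mul']
  push_cast
  rfl

theorem JHat_unitary {ħ : ℝ} (hħ : 0 < ħ) (ψ φ : 𝓢(Config n, ℂ)) :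
    ∫ x, conj (JHat hħ ψ x) * JHat hħ φ x = ∫ x, conj (ψ x) * φ x := by
  have h1 : ∀ (χ : 𝓢(Config n, ℂ)) (ξ : Config n),
      JHat hħ χ ξ = Complex.exp (((-(n * π / 4) : ℝ) : ℂ) * Complex.I) *
      (((2 * π * ħ) ^ (-(n : ℝ) / 2) : ℝ) : ℂ) * 𝓕 χ ((2 * π * ħ)⁻¹ • ξ) := fun _ _ => rfl
  have h0 : 0 < 2 * π * ħ := by positivity
  simp only [h1, conj_mul_mul]
  rw [integral_const_mul, Measure.integral_comp_smul volume (fun y => conj (𝓕 ψ y) * 𝓕 φ y)]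
  have hP := integral_inner_fourier_fourier ψ φ
  have hP' : ∫ y, conj (𝓕 ψ y) * 𝓕 φ y = ∫ x, conj (ψ x) * φ x := by
    simpa [RCLike.inner_apply, mul_comm] using hP
  rw [hP', norm_mul, Complex.norm_exp_ofReal_mul_I, one_mul, Complex.norm_real,
    Real.norm_of_nonneg (by positivity), ← Real.rpow_natCast, ← Real.rpow_mul h0.le,
    finrank_euclideanSpace_fin, abs_of_nonneg (by positivity), ← inv_pow, inv_inv,
    Complex.real_smul, ← mul_assoc, ← Complex.ofReal_mul, ← Real.rpow_natCast,
    ← Real.rpow_add h0]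
  norm_num

theorem det_glEquiv (L : GL (Fin n) ℝ) :
    ((glEquiv L : Config n ≃L[ℝ] Config n) : Config n →L[ℝ] Config n).det =
      (L : Matrix (Fin n) (Fin n) ℝ).det := by
  change LinearMap.det (Matrix.toLpLin 2 2 (L : Matrix (Fin n) (Fin n) ℝ)) = _
  rw [Matrix.toLpLin_eq_toLin, LinearMap.det_toLin]

theorem MHat_unitary (L : GL (Fin n) ℝ) (m : ℤ) (ψ φ : 𝓢(Config n, ℂ)) :
    ∫ x, conj (MHat L m ψ x) * MHat L m φ x = ∫ x, conj (ψ x) * φ x := by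
  have h : (L : Matrix (Fin n) (Fin n) ℝ).det ≠ 0 :=
    ((Matrix.isUnit_iff_isUnit_det _).1 L.isUnit).ne_zero
  simp only [MHat_apply, conj_mul_mul]
  rw [integral_const_mul, integral_comp_cle (glEquiv L) (fun y => conj (ψ y) * φ y), det_glEquiv,
    ← mul_assoc, ← Complex.ofReal_mul, norm_mul, norm_zpow, Complex.norm_I, one_zpow, one_mul,
    Complex.norm_real, Real.norm_of_nonneg (Real.sqrt_nonneg _), Real.sq_sqrt (abs_nonneg _),
    mul_inv_cancel₀ (abs_ne_zero.2 h)]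
  simp

theorem VHat_unitary (ħ : ℝ) (P : Matrix (Fin n) (Fin n) ℝ) (ψ φ : 𝓢(Config n, ℂ)) :
    ∫ x, conj (VHat ħ P ψ x) * VHat ħ P φ x = ∫ x, conj (ψ x) * φ x := by
  simp only [VHat_apply, conj_mul_mul, Complex.norm_exp_ofReal_mul_I]
  simp

/-- Metaplectic operators preserve the inner product of `L²(ℝⁿ)`. -/
theorem Mp_unitary {ħ : ℝ} (hħ : 0 < ħ) (S : Mp n hħ) (ψ φ : 𝓢(Config n, ℂ)) :
    ∫ x, conj (S.1 ψ x) * S.1 φ x = ∫ x, conj (ψ x) * φ x := by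
  obtain ⟨B, hB⟩ := S
  change ∫ x, conj (B ψ x) * B φ x = _
  induction hB using Subgroup.closure_induction generalizing ψ φ with
  | mem g hg =>
    obtain ⟨g, hg, rfl⟩ := hg
    cases hg with
    | J => exact JHat_unitary hħ ψ φ
    | M L m hm => exact MHat_unitary L m ψ φ
    | V P hP => exact VHat_unitary ħ P ψ φ
  | one => rfl
  | mul g h _ _ hg hh =>
    simp only [cle_mul_apply, hh, hg]
  | inv g _ hg =>
    rw [← hg, cle_apply_inv, cle_apply_inv]

/-- Complex conjugation of Schwartz functions. -/
def conjSchwartz : 𝓢(Config n, ℂ) →L⋆[ℂ] 𝓢(Config n, ℂ) :=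
  mkCLM (fun ψ x => conj (ψ x)) (fun _ _ _ => by simp) (fun _ _ _ => by simp)
    (fun ψ => Complex.conjCLE.contDiff.comp (ψ.smooth ⊤)) <| by
  rintro ⟨k, m⟩
  refine ⟨{(k, m)}, 1, zero_le_one, fun ψ x => ?_⟩
  have h : ‖iteratedFDeriv ℝ m (fun x => conj (ψ x)) x‖ = ‖iteratedFDeriv ℝ m ψ x‖ :=
    Complex.conjLIE.norm_iteratedFDeriv_comp_left (𝕜 := ℝ) ψ x m
  rw [h]
  simpa using ψ.le_seminorm ℂ k m x

@[simp] theorem conjSchwartz_apply (ψ : 𝓢(Config n, ℂ)) (x : Config n) :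
    conjSchwartz ψ x = conj (ψ x) := rfl

/-- The extension of a metaplectic operator to `𝓢'(ℝⁿ)`:
`⟨ŜT, φ⟩ = ⟨T, conj (Ŝ⁻¹ (conj φ))⟩`. -/
def extendDist {ħ : ℝ} {hħ : 0 < ħ} (S : Mp n hħ) : 𝓢'(Config n, ℂ) →L[ℂ] 𝓢'(Config n, ℂ) :=
  PointwiseConvergenceCLM.precomp ℂ
    (conjSchwartz.comp ((S⁻¹).1.toContinuousLinearMap.comp conjSchwartz) :
      𝓢(Config n, ℂ) →L[ℂ] 𝓢(Config n, ℂ))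

theorem extendDist_apply {ħ : ℝ} {hħ : 0 < ħ} (S : Mp n hħ) (T : 𝓢'(Config n, ℂ))
    (φ : 𝓢(Config n, ℂ)) :
    extendDist S T φ = T (conjSchwartz ((S⁻¹).1 (conjSchwartz φ))) := rfl

/-- `extendDist S` extends `S`. -/
theorem extendDist_coe {ħ : ℝ} {hħ : 0 < ħ} (S : Mp n hħ) (ψ : 𝓢(Config n, ℂ)) :
    extendDist S (ψ : 𝓢'(Config n, ℂ)) = (S.1 ψ : 𝓢(Config n, ℂ)) := by
  ext φ
  rw [extendDist_apply, SchwartzMap.coe_apply, SchwartzMap.coe_apply]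
  have h := Mp_unitary hħ S⁻¹ (conjSchwartz φ) (S.1 ψ)
  have e : (S⁻¹).1 (S.1 ψ) = ψ := cle_inv_apply S.1 ψ
  rw [e] at h
  simpa using h

end BornJordan

end

/-! ### Symplectic invariance of the symplectic Fourier transform. -/

namespace BornJordan

variable {n : ℕ}

/-! Tested against `φ`, the operator `Op_BJ(a)ψ` is, up to a constant, `a_σ` evaluated on the
Schwartz function `Θ · W(ψ, φ)`, where `W(ψ, φ)(z) = ⟨T̂(z)ψ, φ⟩`. Conjugation by `Ŝ` changes only
`W`, and composing `a` with `s⁻¹` changes only `a_σ`. The theorem says that the two changes agree,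
and it rests on three invariance facts.

First, `(a ∘ s⁻¹)_σ = a_σ ∘ s⁻¹` for every symplectic `s`, because the kernel of the transform
depends on `σ` alone and `s` preserves both `σ` and Lebesgue measure (`sympFourier_distComp`).
Second, `Ŝ T̂(z) Ŝ⁻¹ = T̂(sz)` together with unitarity turns the coefficient of the conjugated
operator into `W(ψ, φ)(sz)` (`matrixCoeff_inv`). Both facts hold on the whole metaplectic group.

Third, `Θ ∘ s = Θ` (`theta_of_mem_mpBJ`), and this is where the subgroup matters. `Θ` is an even
function of `p · x`; `M_L` fixes `p · x` and `J` changes its sign, whereas `V_P` replaces it by `p ·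
x - Px · x`. With the three facts in hand, both sides evaluate `a_σ` on the same test function `(Θ ·
W(ψ, φ)) ∘ s`. -/

theorem sympForm_eq_dotProduct (z w : Phase n) :
    sympForm z w = z.ofLp ⬝ᵥ (Matrix.J (Fin n) ℝ *ᵥ w.ofLp) := by
  -- `Matrix.J` is `(0, -I; I, 0)`, the negative of the `J` in `σ(z, w) = Jz · w`. Moving the
  -- antisymmetric `J` to the second factor produces exactly this sign.
  simp [sympForm, Matrix.J, Matrix.mulVec, dotProduct, Fintype.sum_sum_type, PiLp.inner_apply,
    Matrix.one_apply, Matrix.fromBlocks]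
  simp only [mul_comm]
  ring

/-- Symplectic matrices preserve the symplectic form. -/
theorem sympForm_sympEquiv (s : Matrix.symplecticGroup (Fin n) ℝ) (z w : Phase n) :
    sympForm (sympEquiv s z) (sympEquiv s w) = sympForm z w := by
  -- Membership is defined by `s J sᵀ = J`; invariance of the form needs the equivalent identity
  -- with the transpose on the left.
  have h : (s : Matrix _ _ ℝ)ᵀ * Matrix.J (Fin n) ℝ * (s : Matrix _ _ ℝ) = Matrix.J (Fin n) ℝ :=
    SymplecticGroup.mem_iff'.1 s.2
  simp only [sympForm_eq_dotProduct, sympEquiv_apply]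
  conv_rhs => rw [← h]
  rw [← Matrix.mulVec_mulVec, ← Matrix.mulVec_mulVec, Matrix.dotProduct_mulVec z.ofLp,
    Matrix.vecMul_transpose]

/-- Symplectic matrices have determinant one. The absolute value is the Jacobian factor occurring in
`distComp` and `integral_comp_cle`, so both lose their factor for symplectic maps. -/
theorem abs_det_sympEquiv (s : Matrix.symplecticGroup (Fin n) ℝ) :
    |((sympEquiv s : Phase n ≃L[ℝ] Phase n) : Phase n →L[ℝ] Phase n).det| = 1 := by
  change |LinearMap.det (Matrix.toLpLin 2 2 (s : Matrix (Fin n ⊕ Fin n) (Fin n ⊕ Fin n) ℝ))| = 1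
  rw [Matrix.toLpLin_eq_toLin, LinearMap.det_toLin, SymplecticGroup.det_eq_one s.2, abs_one]

/-- Translates between the Euclidean pairing in the kernel of `𝓕` and `σ`, so that invariance of `σ`
can be used inside Fourier integrals. -/
theorem inner_scaledJ {ħ : ℝ} (hħ : 0 < ħ) (z w : Phase n) :
    ⟪scaledJ hħ z, w⟫_ℝ = (2 * π * ħ)⁻¹ * sympForm z w := by
  simp only [scaledJ, phaseEquiv_apply, phase_inner, pos_phasePt, mom_phasePt, sympForm,
    real_inner_smul_left]
  rw [real_inner_comm (mom w)]
  ring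

/-- Used with `k = scaledJ hħ` and `g` symplectic: `k g k⁻¹` then preserves volume, and the
determinant of `k` need not be computed. -/
theorem det_conj (g k : Phase n ≃L[ℝ] Phase n) :
    (((k.symm.trans g).trans k : Phase n ≃L[ℝ] Phase n) : Phase n →L[ℝ] Phase n).det =
      (g : Phase n →L[ℝ] Phase n).det :=
  LinearMap.det_conj (g : Phase n →ₗ[ℝ] Phase n) k.toLinearEquiv

/-- Write `k` for `scaledJ hħ`. The map `k s k⁻¹` is the inverse transpose of `s`: by invariance of
`σ`, `⟨k s k⁻¹ w, s z⟩ = (2πħ)⁻¹ σ(s k⁻¹ w, s z) = (2πħ)⁻¹ σ(k⁻¹ w, z) = ⟨w, z⟩`. Substituting `w ↦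
k s k⁻¹ w` in the Fourier integral at `s z` therefore gives the kernel at `z` and turns `f ∘ k⁻¹`
into `f ∘ s ∘ k⁻¹`. -/
theorem fourier_comp_scaledJ_symm {ħ : ℝ} (hħ : 0 < ħ) (s : Matrix.symplecticGroup (Fin n) ℝ)
    (f : 𝓢(Phase n, ℂ)) :
    compCLMOfContinuousLinearEquiv ℂ (sympEquiv s)
        (𝓕 (compCLMOfContinuousLinearEquiv ℂ (scaledJ hħ).symm f)) =
      𝓕 (compCLMOfContinuousLinearEquiv ℂ (scaledJ hħ).symm
        (compCLMOfContinuousLinearEquiv ℂ (sympEquiv s) f)) := by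
  ext z
  rw [compCLMOfContinuousLinearEquiv_apply, Function.comp_apply, fourier_coe, fourier_coe,
    Real.fourier_eq', Real.fourier_eq']
  -- `trans` composes from left to right, so this is the substitution by `k s k⁻¹`.
  have h := integral_comp_cle (((scaledJ hħ).symm.trans (sympEquiv s)).trans (scaledJ hħ))
    fun w => Complex.exp (((-2 * π * ⟪w, sympEquiv s z⟫_ℝ : ℝ) : ℂ) * Complex.I) •
      compCLMOfContinuousLinearEquiv ℂ (scaledJ hħ).symm f w
  rw [det_conj, abs_det_sympEquiv, inv_one, Complex.ofReal_one, one_mul] at h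
  rw [← h]
  congr 1
  ext w
  have e : ⟪scaledJ hħ (sympEquiv s ((scaledJ hħ).symm w)), sympEquiv s z⟫_ℝ = ⟪w, z⟫_ℝ := by
    rw [inner_scaledJ, sympForm_sympEquiv, ← inner_scaledJ hħ, ContinuousLinearEquiv.apply_symm_apply]
  simp [e]

/-- Composition and `𝓕` act on distributions by transposition, so on the test function they appear
in reverse order. The scalar factors are independent of `a` and `f`, which reduces invariance to an
identity between test functions. -/
theorem sympFourier_apply {ħ : ℝ} (hħ : 0 < ħ) (a : 𝓢'(Phase n, ℂ)) (f : 𝓢(Phase n, ℂ)) :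
    sympFourier hħ a f = (((1 / (2 * π * ħ)) ^ n : ℝ) : ℂ) *
      (((|((scaledJ hħ : Phase n ≃L[ℝ] Phase n) : Phase n →L[ℝ] Phase n).det|⁻¹ : ℝ) : ℂ) *
        a (𝓕 (compCLMOfContinuousLinearEquiv ℂ (scaledJ hħ).symm f))) := rfl

/-- The symplectic Fourier transform commutes with symplectic automorphisms. -/
theorem sympFourier_distComp {ħ : ℝ} (hħ : 0 < ħ) (a : 𝓢'(Phase n, ℂ))
    (s : Matrix.symplecticGroup (Fin n) ℝ) (f : 𝓢(Phase n, ℂ)) :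
    sympFourier hħ (distComp a (sympEquiv s⁻¹)) f =
      sympFourier hħ a (compCLMOfContinuousLinearEquiv ℂ (sympEquiv s) f) := by
  -- `distComp` composes the test function with the inverse automorphism; for `s⁻¹` that is `s`
  -- itself.
  have hs : (sympEquiv s⁻¹ : Phase n ≃L[ℝ] Phase n).symm = sympEquiv s := by
    rw [map_inv]; rfl
  rw [sympFourier_apply, sympFourier_apply, distComp_apply, abs_det_sympEquiv, hs,
    fourier_comp_scaledJ_symm]
  simp

/-! ### Matrix coefficients under metaplectic operators. -/

/-- Metaplectic covariance of the matrix coefficients of the Heisenberg operators. -/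
theorem matrixCoeff_inv {ħ : ℝ} (hħ : 0 < ħ) (S : Mp n hħ) (ψ φ : 𝓢(Config n, ℂ)) (z : Phase n) :
    matrixCoeff hħ ((S⁻¹).1 ψ) (conjSchwartz ((S⁻¹).1 (conjSchwartz φ))) z =
      matrixCoeff hħ ψ φ (sympEquiv (projMp hħ S) z) := by
  -- The conjugation around `Ŝ⁻¹` turns the bilinear pairing on the left into the Hermitian inner
  -- product of `Ŝ⁻¹ φ̄` and `T̂(z)Ŝ⁻¹ψ`. Applying `Ŝ` to both entries preserves it; intertwining
  -- then gives `T̂(sz)ψ` paired with `φ`.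
  have h := Mp_unitary hħ S ((S⁻¹).1 (conjSchwartz φ)) (heisenberg ħ z ((S⁻¹).1 ψ))
  have e (χ : 𝓢(Config n, ℂ)) : S.1 ((S⁻¹).1 χ) = χ := cle_apply_inv S.1 χ
  rw [Mp_heisenberg, e, e] at h
  simp only [matrixCoeff_apply]
  simpa [mul_comm] using h.symm

/-! ### Invariance of `Θ` under the subgroup. -/

/-- The subgroup generated by `Ĵ` and the `M̂_{L,m}` preserves `p · x` up to sign. -/
theorem inner_mom_pos_of_mem_mpBJ {ħ : ℝ} (hħ : 0 < ħ) {S : Mp n hħ} (hS : S ∈ mpBJ n hħ) :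
    ∃ ε : ℝ, (ε = 1 ∨ ε = -1) ∧ ∀ z : Phase n,
      ⟪mom (sympEquiv (projMp hħ S) z), pos (sympEquiv (projMp hħ S) z)⟫_ℝ =
        ε * ⟪mom z, pos z⟫_ℝ := by
  induction hS using Subgroup.closure_induction with
  | mem S hS =>
    rcases hS with rfl | ⟨L, m, hm, rfl⟩
    · refine ⟨-1, Or.inr rfl, fun z => ?_⟩
      rw [projMp_J, pos_sympJ, mom_sympJ, inner_neg_left, real_inner_comm, neg_one_mul]
    -- Here `Lᵀp · L⁻¹x = p · x`.
    · refine ⟨1, Or.inl rfl, fun z => ?_⟩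
      rw [projMp_M, inner_mom_sympM, pos_sympM, ContinuousLinearEquiv.apply_symm_apply, one_mul]
  | one => exact ⟨1, Or.inl rfl, fun z => by rw [map_one, map_one, one_mul]; rfl⟩
  | mul S T _ _ hS hT =>
    obtain ⟨ε, hε, hS⟩ := hS
    obtain ⟨δ, hδ, hT⟩ := hT
    refine ⟨ε * δ, ?_, fun z => ?_⟩
    · rcases hε with rfl | rfl <;> rcases hδ with rfl | rfl <;> simp
    · rw [map_mul, map_mul, cle_mul_apply, hS, hT, mul_assoc]
  | inv S _ hS =>
    obtain ⟨ε, hε, hS⟩ := hS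
    refine ⟨ε, hε, fun z => ?_⟩
    have h := hS ((sympEquiv (projMp hħ S))⁻¹ z)
    rw [cle_apply_inv] at h
    -- The same sign serves for the inverse because `ε * ε = 1`.
    rw [map_inv, map_inv, h, ← mul_assoc]
    rcases hε with rfl | rfl <;> simp

/-- The function `sinc` is even, so the undetermined sign of `p · x` is harmless. -/
theorem theta_of_mem_mpBJ {ħ : ℝ} (hħ : 0 < ħ) {S : Mp n hħ} (hS : S ∈ mpBJ n hħ) (z : Phase n) :
    theta ħ (sympEquiv (projMp hħ S) z) = theta ħ z := by
  obtain ⟨ε, hε, h⟩ := inner_mom_pos_of_mem_mpBJ hħ hS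
  rw [theta, theta, h]
  rcases hε with rfl | rfl
  · rw [one_mul]
  · rw [neg_one_mul, neg_div, Real.sinc_neg]

end BornJordan

/-! ### Covariance of Born–Jordan operators. -/

theorem mainTheorem1 (n : ℕ) (ħ : ℝ) (hħ : 0 < ħ) (a : 𝓢'(BornJordan.Phase n, ℂ))
    (S : BornJordan.Mp n hħ) (hS : S ∈ BornJordan.mpBJ n hħ) :
    (BornJordan.extendDist S) ∘L (BornJordan.opBJ hħ a) ∘L
        ((S⁻¹).1 : 𝓢(BornJordan.Config n, ℂ) →L[ℂ] 𝓢(BornJordan.Config n, ℂ)) =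
      BornJordan.opBJ hħ
        (BornJordan.distComp a (BornJordan.sympEquiv (BornJordan.projMp hħ S)⁻¹)) := by
  open BornJordan in
  ext ψ φ
  change extendDist S (opBJ hħ a ((S⁻¹).1 ψ)) φ = _
  rw [extendDist_apply, opBJ_apply, opBJ_apply, sympFourier_distComp]
  -- Both sides are now the same constant times `a_σ` on a test function. It remains to compare `Θ`
  -- times the coefficient of the transformed pair with `(Θ · W(ψ, φ)) ∘ s`, pointwise.
  congr 2
  ext z
  rw [compCLMOfContinuousLinearEquiv_apply, Function.comp_apply,
    smulLeftCLM_apply_apply (theta_growth ħ), smulLeftCLM_apply_apply (theta_growth ħ),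
    matrixCoeff_inv, theta_of_mem_mpBJ hħ hS]
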